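/- For a set $S \subseteq \mathbb{R}^2$, a convex polygon (the convex hull of finitely many points) with all its vertices in $S$ is called \emph{empty in $S$} if it contains no point of $S$ other than its vertices. Let $h(S) \in \mathbb{N}_0 \cup \{\infty\}$ denote the maximum number of vertices of a convex polygon that is empty in $S$, with $h(S)=\infty$ if there are such polygons with arbitrarily many vertices. For real $\alpha > 1$ let $L(\alpha) = \{\alpha^n : n \in \mathbb{N}_0\}^2 = \{(\alpha^m,\alpha^n) : m,n \in \mathbb{N}_0\}$ and $h(\alpha) = h(L(\alpha))$. Then $h(\alpha)$ is finite for every real $\alpha > 1$. More precisely, \begin{itemize} \item $h(\alpha) \le 5$ for every $\alpha \ge 2$; \item $h(\alpha) \le 7$ for every $\alpha \in \left[\frac{1+\sqrt5}{2}, 2\right)$; \item $h(\alpha) \le 3\left\lceil \log_\alpha\!\left(\frac{\alpha}{\alpha-1}\right)\right\rceil + 3$ for every $\alpha \in \left(1, \frac{1+\sqrt5}{2}\right)$. \end{itemize} -/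

import Mathlib

/-- A convex polytope: the convex hull of finitely many points. -/
def IsConvexPolytope {E : Type*} [AddCommGroup E] [Module ℝ E] (P : Set E) : Prop :=
  ∃ V : Set E, V.Finite ∧ P = convexHull ℝ V

/-- `P` is an empty polytope in `S`: a convex polytope whose vertices (extreme points) all belong
to `S`, and which contains no point of `S` other than its vertices. -/
def IsEmptyPolytopeIn {E : Type*} [AddCommGroup E] [Module ℝ E] (S P : Set E) : Prop :=
  IsConvexPolytope P ∧ P.extremePoints ℝ ⊆ S ∧ P ∩ S ⊆ P.extremePoints ℝ

/-- `maxEmptyVertices S` is `h(S)`: the maximum number of vertices of an empty polytope in `S`,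
and `⊤` if there are empty polytopes in `S` with arbitrarily many vertices. -/
noncomputable def maxEmptyVertices {E : Type*} [AddCommGroup E] [Module ℝ E] (S : Set E) : ℕ∞ :=
  ⨆ (P : Set E) (_ : IsEmptyPolytopeIn S P), (P.extremePoints ℝ).encard

/-- The exponential lattice `L(α) = {αⁿ : n ∈ ℕ₀}²` in the plane. -/
def expLattice (α : ℝ) : Set (ℝ × ℝ) :=
  {α ^ n | n : ℕ} ×ˢ {α ^ n | n : ℕ}

/-! Everything reduces to one bound: 2k + 3 vertices whenever 1/α + 1/α^k ≤ 1, which is `hk`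
rearranged. This holds with k = 1 for α ≥ 2, with k = 2 once α² ≥ α + 1, and with k =
⌈log_α(α/(α-1))⌉ always.

An empty polygon stays empty when all integer exponents are allowed, since it lies in x, y ≥ 1. In
homogeneous coordinates [1 : α^m : α^n], the enlarged lattice is invariant under cyclic permutation,
so the origin and the two points at infinity on the axes (O, X, Y) play equal roles.

Classify vertices by the signs of a supporting functional c₀ + c₁x + c₂y. At most k + 2 face O
(`card_lowerVertices_le`). Of the three possible corners, opposite O, X and Y, at least two exist
(`hasCornerX_or_hasCornerY`); by symmetry take those opposite X and Y. Past four vertices, each of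
these leaves at most two vertices facing X, respectively Y (`card_le_four_of_card_lowerVertices`),
one of them already facing O. The other vertices face away from O and number at most k - 1
(`card_remainingVertices_lt`). The total is (k + 2) + 1 + 1 + (k - 1). -/

section Exponents

variable {α : ℝ}

/-! ### Supporting lines and the projective symmetry -/

/-- `SupportsAt α V v c₀ c₁ c₂`: the affine functional `c₀ + c₁ x + c₂ y` is positive on `V`
except at `v`, where it is not. -/
def SupportsAt (α : ℝ) (V : Finset (ℤ × ℤ)) (v : ℤ × ℤ) (c₀ c₁ c₂ : ℝ) : Prop :=
  c₀ + c₁ * α ^ v.1 + c₂ * α ^ v.2 ≤ 0 ∧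
    ∀ w ∈ V, w ≠ v → 0 < c₀ + c₁ * α ^ w.1 + c₂ * α ^ w.2

/-- `StrictlySeparated α V`: in the plane, with `(m, n)` standing for the point `(α ^ m, α ^ n)`,
no point lies in the convex hull of the points of `V` different from it. -/
def StrictlySeparated (α : ℝ) (V : Finset (ℤ × ℤ)) : Prop :=
  ∀ z : ℤ × ℤ, ∃ c₀ c₁ c₂ : ℝ, SupportsAt α V z c₀ c₁ c₂

/-- The cyclic projective symmetry of the exponential lattice. -/
def rotateExp (v : ℤ × ℤ) : ℤ × ℤ := (v.2 - v.1, -v.1)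

lemma rotateExp_injective : Function.Injective rotateExp := by
  rintro ⟨a, b⟩ ⟨c, d⟩ h
  simp only [rotateExp, Prod.mk.injEq] at h
  ext <;> simp <;> omega

lemma rotateExp_surjective : Function.Surjective rotateExp := by
  rintro ⟨a, b⟩
  exact ⟨(-b, a - b), by simp [rotateExp]⟩

/-- Dividing (1, α^m, α^n) by α^m > 0 keeps all signs and, after a cyclic shift, gives the
homogeneous coordinates of the rotated point. -/
lemma SupportsAt.rotate (hα : 1 < α) {V : Finset (ℤ × ℤ)} {v : ℤ × ℤ} {c₀ c₁ c₂ : ℝ}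
    (h : SupportsAt α V v c₀ c₁ c₂) :
    SupportsAt α (V.image rotateExp) (rotateExp v) c₁ c₂ c₀ := by
  have h0 : α ≠ 0 := by positivity
  have key : ∀ v : ℤ × ℤ,
      c₁ + c₂ * α ^ (rotateExp v).1 + c₀ * α ^ (rotateExp v).2 =
        α ^ (-v.1) * (c₀ + c₁ * α ^ v.1 + c₂ * α ^ v.2) := by
    intro v
    have e1 : α ^ (-v.1) * α ^ v.1 = 1 := by rw [← zpow_add₀ h0]; simp
    have e2 : α ^ (v.2 - v.1) = α ^ (-v.1) * α ^ v.2 := by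
      rw [← zpow_add₀ h0]; congr 1; ring
    simp only [rotateExp, e2]
    linear_combination (-c₁) * e1
  refine ⟨?_, ?_⟩
  · rw [key]
    exact mul_nonpos_of_nonneg_of_nonpos (by positivity) h.1
  · intro w' hw' hne
    obtain ⟨w, hwV, rfl⟩ := Finset.mem_image.1 hw'
    rw [key]
    exact mul_pos (by positivity) (h.2 w hwV fun e => hne (by rw [e]))

lemma StrictlySeparated.rotate (hα : 1 < α) {V : Finset (ℤ × ℤ)} (h : StrictlySeparated α V) :
    StrictlySeparated α (V.image rotateExp) := by
  intro z'
  obtain ⟨z, rfl⟩ := rotateExp_surjective z'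
  obtain ⟨c₀, c₁, c₂, hz⟩ := h z
  exact ⟨c₁, c₂, c₀, hz.rotate hα⟩

lemma mul_zpow_le_zpow (hα : 1 < α) {i j : ℤ} (h : i < j) : α * α ^ i ≤ α ^ j := by
  have h0 : α ≠ 0 := by positivity
  rw [← zpow_one_add₀ h0]
  exact zpow_le_zpow_right₀ hα.le (by omega)

lemma pow_mul_zpow_le_zpow (hα : 1 < α) {i j : ℤ} (k : ℕ) (h : i + k ≤ j) :
    α ^ k * α ^ i ≤ α ^ j := by
  have h0 : α ≠ 0 := by positivity
  rw [← zpow_natCast, ← zpow_add₀ h0]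
  exact zpow_le_zpow_right₀ hα.le (by omega)

/-! ### Vertices facing the origin -/

/-- The vertices on the part of the boundary facing the origin. -/
noncomputable def lowerVertices (α : ℝ) (V : Finset (ℤ × ℤ)) : Finset (ℤ × ℤ) :=
  open Classical in
  V.filter fun v => ∃ a b : ℝ, 0 ≤ a ∧ 0 ≤ b ∧ 0 < a + b ∧
    ∀ w ∈ V, a * α ^ v.1 + b * α ^ v.2 ≤ a * α ^ w.1 + b * α ^ w.2

lemma mem_lowerVertices {V : Finset (ℤ × ℤ)} {v : ℤ × ℤ} :
    v ∈ lowerVertices α V ↔ v ∈ V ∧ ∃ a b : ℝ, 0 ≤ a ∧ 0 ≤ b ∧ 0 < a + b ∧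
      ∀ w ∈ V, a * α ^ v.1 + b * α ^ v.2 ≤ a * α ^ w.1 + b * α ^ w.2 := by
  simp [lowerVertices]

lemma lowerVertices_subset {V : Finset (ℤ × ℤ)} : lowerVertices α V ⊆ V :=
  fun _ h => (mem_lowerVertices.1 h).1

lemma mem_lowerVertices_of_fst_le (hα : 1 < α) {V : Finset (ℤ × ℤ)} {v : ℤ × ℤ} (hv : v ∈ V)
    (h : ∀ w ∈ V, v.1 ≤ w.1) : v ∈ lowerVertices α V :=
  mem_lowerVertices.2 ⟨hv, 1, 0, by simp, by simp, by simp, fun w hw => by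
    simpa using zpow_le_zpow_right₀ hα.le (h w hw)⟩

lemma mem_lowerVertices_of_snd_le (hα : 1 < α) {V : Finset (ℤ × ℤ)} {v : ℤ × ℤ} (hv : v ∈ V)
    (h : ∀ w ∈ V, v.2 ≤ w.2) : v ∈ lowerVertices α V :=
  mem_lowerVertices.2 ⟨hv, 0, 1, by simp, by simp, by simp, fun w hw => by
    simpa using zpow_le_zpow_right₀ hα.le (h w hw)⟩

/-- A lower vertex with a vertex strictly below it has least first coordinate. -/
lemma fst_le_of_mem_lowerVertices (hα : 1 < α) {V : Finset (ℤ × ℤ)} {v w : ℤ × ℤ}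
    (hv : v ∈ lowerVertices α V) (hw : w ∈ V) (h1 : w.1 ≤ v.1) (h2 : w.2 < v.2) :
    ∀ u ∈ V, v.1 ≤ u.1 := by
  obtain ⟨-, a, b, ha, hb, hab, h⟩ := mem_lowerVertices.1 hv
  have e1 := zpow_le_zpow_right₀ hα.le h1
  have e2 := zpow_lt_zpow_right₀ hα h2
  have e3 := h w hw
  have hb0 : b = 0 := by
    by_contra hne
    have : 0 < b := lt_of_le_of_ne hb (Ne.symm hne)
    nlinarith
  subst hb0
  intro u hu
  have e4 := h u hu
  have ha' : 0 < a := by linarith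
  have : α ^ v.1 ≤ α ^ u.1 := by
    by_contra hlt
    push Not at hlt
    nlinarith
  exact (zpow_le_zpow_iff_right₀ hα).1 this

lemma snd_le_of_mem_lowerVertices (hα : 1 < α) {V : Finset (ℤ × ℤ)} {v w : ℤ × ℤ}
    (hv : v ∈ lowerVertices α V) (hw : w ∈ V) (h1 : w.1 < v.1) (h2 : w.2 ≤ v.2) :
    ∀ u ∈ V, v.2 ≤ u.2 := by
  obtain ⟨-, a, b, ha, hb, hab, h⟩ := mem_lowerVertices.1 hv
  have e1 := zpow_lt_zpow_right₀ hα h1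
  have e2 := zpow_le_zpow_right₀ hα.le h2
  have e3 := h w hw
  have ha0 : a = 0 := by
    by_contra hne
    have : 0 < a := lt_of_le_of_ne ha (Ne.symm hne)
    nlinarith
  subst ha0
  intro u hu
  have e4 := h u hu
  have hb' : 0 < b := by linarith
  have : α ^ v.2 ≤ α ^ u.2 := by
    by_contra hlt
    push Not at hlt
    nlinarith
  exact (zpow_le_zpow_iff_right₀ hα).1 this

/-- The boundary facing the origin is a descending staircase, so ordering by the slope exponent n -
m orders both coordinates. -/
lemma lowerVertices_antitone (hα : 1 < α) {V : Finset (ℤ × ℤ)} {v w : ℤ × ℤ}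
    (hv : v ∈ lowerVertices α V) (hw : w ∈ lowerVertices α V) (h : w.2 - w.1 ≤ v.2 - v.1) :
    v.1 ≤ w.1 ∧ w.2 ≤ v.2 := by
  have hvV := lowerVertices_subset hv
  have hwV := lowerVertices_subset hw
  by_contra hcon
  rw [not_and_or] at hcon
  rcases lt_or_ge w.1 v.1 with h1 | h1
  · have := snd_le_of_mem_lowerVertices hα hv hwV h1 (by omega) w hwV
    have := fst_le_of_mem_lowerVertices hα hv hwV h1.le
    omega
  · have h2 : v.2 < w.2 := by omega
    have := fst_le_of_mem_lowerVertices hα hw hvV h1 h2 v hvV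
    omega

lemma StrictlySeparated.not_vertical (hα : 1 < α) {V : Finset (ℤ × ℤ)} (h : StrictlySeparated α V)
    {p q r : ℤ × ℤ} (hp : p ∈ V) (hr : r ∈ V) (h1 : p.1 = q.1) (h2 : r.1 = q.1)
    (h3 : q.2 < p.2) (h4 : r.2 < q.2) : False := by
  obtain ⟨c₀, c₁, c₂, hz, hw⟩ := h q
  have e1 := hw p hp (by rintro rfl; omega)
  have e2 := hw r hr (by rintro rfl; omega)
  rw [h1] at e1
  rw [h2] at e2
  have e3 := zpow_lt_zpow_right₀ hα h3
  have e4 := zpow_lt_zpow_right₀ hα h4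
  rcases le_or_gt c₂ 0 with hc | hc <;> nlinarith

lemma StrictlySeparated.not_horizontal (hα : 1 < α) {V : Finset (ℤ × ℤ)}
    (h : StrictlySeparated α V) {p q r : ℤ × ℤ} (hp : p ∈ V) (hr : r ∈ V) (h1 : p.2 = q.2)
    (h2 : r.2 = q.2) (h3 : q.1 < p.1) (h4 : r.1 < q.1) : False := by
  obtain ⟨c₀, c₁, c₂, hz, hw⟩ := h q
  have e1 := hw p hp (by rintro rfl; omega)
  have e2 := hw r hr (by rintro rfl; omega)
  rw [h1] at e1
  rw [h2] at e2
  have e3 := zpow_lt_zpow_right₀ hα h3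
  have e4 := zpow_lt_zpow_right₀ hα h4
  rcases le_or_gt c₁ 0 with hc | hc <;> nlinarith

/-- Three consecutive lower vertices: the middle one is strictly below the first and strictly to
the left of the last. -/
lemma lowerVertices_middle (hα : 1 < α) {V : Finset (ℤ × ℤ)} (h : StrictlySeparated α V)
    {q p r : ℤ × ℤ} (hq : q ∈ lowerVertices α V) (hp : p ∈ lowerVertices α V)
    (hr : r ∈ lowerVertices α V) (hqp : q ≠ p) (hpr : p ≠ r)
    (h1 : p.2 - p.1 ≤ q.2 - q.1) (h2 : r.2 - r.1 ≤ p.2 - p.1) :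
    q.1 ≤ p.1 ∧ p.2 < q.2 ∧ p.1 < r.1 ∧ r.2 ≤ p.2 := by
  obtain ⟨a1, a2⟩ := lowerVertices_antitone hα hq hp h1
  obtain ⟨b1, b2⟩ := lowerVertices_antitone hα hp hr h2
  have hqV := lowerVertices_subset hq
  have hpV := lowerVertices_subset hp
  have hrV := lowerVertices_subset hr
  have hne1 : q.1 ≠ p.1 ∨ q.2 ≠ p.2 := by
    by_contra hc; push Not at hc; exact hqp (Prod.ext hc.1 hc.2)
  have hne2 : p.1 ≠ r.1 ∨ p.2 ≠ r.2 := by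
    by_contra hc; push Not at hc; exact hpr (Prod.ext hc.1 hc.2)
  refine ⟨a1, ?_, ?_, b2⟩
  · by_contra hc
    have hlt : q.1 < p.1 := by omega
    have := snd_le_of_mem_lowerVertices hα hp hqV hlt (by omega) r hrV
    exact h.not_horizontal hα (q := p) hrV hqV (by omega) (by omega) (by omega) hlt
  · by_contra hc
    have hlt : r.2 < p.2 := by omega
    have := fst_le_of_mem_lowerVertices hα hp hrV (by omega) hlt q hqV
    exact h.not_vertical hα (q := p) hqV hrV (by omega) (by omega) (by omega) hlt

lemma card_le_of_injOn_fst {S : Finset (ℤ × ℤ)} (hS : Set.InjOn Prod.fst (S : Set (ℤ × ℤ)))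
    {i j : ℤ} (n : ℕ) (h : ∀ v ∈ S, i ≤ v.1 ∧ v.1 ≤ j) (hn : j + 1 - i ≤ n) : S.card ≤ n := by
  have h1 := Finset.card_le_card_of_injOn (t := Finset.Icc i j) Prod.fst
    (fun v hv => Finset.coe_Icc i j ▸ h v hv) hS
  rw [Int.card_Icc] at h1
  omega

/-- After the steepest vertex q, first exponents are distinct, so k + 3 vertices would spread the
others over a gap of k + 1. Then the right neighbour of the next vertex p lies in the triangle
formed by p, q and the last vertex r. -/
lemma card_lowerVertices_le (hα : 1 < α) {V : Finset (ℤ × ℤ)} (h : StrictlySeparated α V)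
    {k : ℕ} (hk : α ≤ α ^ k * (α - 1)) (hk1 : 1 ≤ k) : (lowerVertices α V).card ≤ k + 2 := by
  by_contra! hcard
  set A := lowerVertices α V with hA
  obtain ⟨q, hq, hqmax⟩ := A.exists_max_image (fun v => v.2 - v.1)
    (Finset.card_pos.1 (by omega))
  have herase := Finset.card_erase_of_mem hq
  have hne : (A.erase q).Nonempty := Finset.card_pos.1 (by omega)
  obtain ⟨p, hp, hpmax⟩ := (A.erase q).exists_max_image (fun v => v.2 - v.1) hne
  obtain ⟨r, hr, hrmin⟩ := (A.erase q).exists_min_image (fun v => v.2 - v.1) hne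
  have hpA := Finset.mem_of_mem_erase hp
  have hrA := Finset.mem_of_mem_erase hr
  have hinj : Set.InjOn Prod.fst ((A.erase q : Finset (ℤ × ℤ)) : Set (ℤ × ℤ)) := by
    have main : ∀ v ∈ A.erase q, ∀ w ∈ A.erase q, v.1 = w.1 → v.2 < w.2 → False := by
      intro v hv w hw hvw hlt
      have hvA := Finset.mem_of_mem_erase hv
      have hwA := Finset.mem_of_mem_erase hw
      have := lowerVertices_middle hα h hq hwA hvA (Finset.ne_of_mem_erase hw).symm
        (by rintro rfl; omega) (hqmax w hwA) (by omega)
      omega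
    intro v hv w hw hvw
    rcases lt_trichotomy v.2 w.2 with hlt | heq | hlt
    · exact (main v hv w hw hvw hlt).elim
    · exact Prod.ext hvw heq
    · exact (main w hw v hv hvw.symm hlt).elim
  have hlong : p.1 + (k + 1 : ℕ) ≤ r.1 := by
    by_contra! hc
    have := card_le_of_injOn_fst hinj (i := p.1) (j := r.1) (k + 1)
      (fun v hv => ⟨(lowerVertices_antitone hα hpA (Finset.mem_of_mem_erase hv) (hpmax v hv)).1,
        (lowerVertices_antitone hα (Finset.mem_of_mem_erase hv) hrA (hrmin v hv)).1⟩)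
      (by push_cast at hc ⊢; omega)
    omega
  obtain ⟨a1, a2, a3, a4⟩ := lowerVertices_middle hα h hq hpA hrA
    (Finset.ne_of_mem_erase hp).symm (by rintro rfl; push_cast at hlong; omega)
    (hqmax p hpA) (hrmin p hp)
  obtain ⟨c₀, c₁, c₂, hz, hw⟩ := h (p.1 + 1, p.2)
  have e1 := hw p (lowerVertices_subset hpA) (by rw [Ne, Prod.ext_iff]; simp)
  have e2 := hw q (lowerVertices_subset hq) (by rw [Ne, Prod.ext_iff]; simp; omega)
  have e3 := hw r (lowerVertices_subset hrA)
    (by rw [Ne, Prod.ext_iff]; push_cast at hlong; simp; omega)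
  have h0 : 0 < α := by positivity
  simp only [zpow_add_one₀ h0.ne'] at hz
  have f2 := mul_zpow_le_zpow hα a2
  have f3 := pow_mul_zpow_le_zpow hα (k + 1) hlong
  have f4 := zpow_le_zpow_right₀ hα.le a4
  have g1 : 0 < α ^ p.1 := by positivity
  have g2 : 0 < α ^ p.2 := by positivity
  have g3 : 0 < α ^ q.1 := by positivity
  have g4 : 0 < α ^ r.2 := by positivity
  have g5 : α ≤ α ^ (k + 1) := le_self_pow₀ hα.le (by omega)
  have g6 : 0 < α ^ k := by positivity
  have hc1 : c₁ < 0 := by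
    by_contra! hc
    nlinarith [mul_nonneg hc (mul_pos g1 (sub_pos.2 hα)).le]
  have hc2 : c₂ < 0 := by
    by_contra! hc
    nlinarith [mul_le_mul_of_nonneg_left f4 hc, mul_le_mul_of_nonneg_right g5 g1.le]
  have i1 : -c₂ * α ^ p.2 * α < c₀ := by nlinarith
  have i2 : -c₁ * α ^ p.1 * α * α ^ k < c₀ := by
    rw [pow_succ] at f3
    nlinarith
  have hB : 0 < -c₂ * α ^ p.2 := by nlinarith
  have hc0 : 0 < c₀ := by nlinarith
  -- `hz`, `i1` and `i2` combine to c₀ < c₀(1/α + 1/α^k).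
  nlinarith [mul_lt_mul_of_pos_left i1 g6, mul_le_mul_of_nonneg_left hz (mul_pos h0 g6).le,
    mul_le_mul_of_nonneg_left hk hc0.le]

/-- A middle lower vertex p and the top right corner t force a unit cell: any missing cell corner
would lie inside the polygon, and a further vertex would break convex position. -/
lemma card_le_four_of_card_lowerVertices (hα : 1 < α) {V : Finset (ℤ × ℤ)}
    (h : StrictlySeparated α V) (hA : 3 ≤ (lowerVertices α V).card)
    (ht : ∃ t ∈ V, ∀ w ∈ V, w.1 ≤ t.1 ∧ w.2 ≤ t.2) : V.card ≤ 4 := by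
  obtain ⟨t, htV, ht⟩ := ht
  have hne : (lowerVertices α V).Nonempty := Finset.card_pos.1 (by omega)
  obtain ⟨q, hq, hqmax⟩ := (lowerVertices α V).exists_max_image (fun v => v.2 - v.1) hne
  obtain ⟨r, hr, hrmin⟩ := (lowerVertices α V).exists_min_image (fun v => v.2 - v.1) hne
  obtain ⟨p, hp, hpqr⟩ : ∃ p ∈ lowerVertices α V, p ∉ ({q, r} : Finset (ℤ × ℤ)) := by
    apply Finset.exists_mem_notMem_of_card_lt_card
    exact lt_of_le_of_lt Finset.card_le_two (by omega)
  simp only [Finset.mem_insert, Finset.mem_singleton, not_or] at hpqr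
  obtain ⟨a1, a2, a3, a4⟩ := lowerVertices_middle hα h hq hp hr (Ne.symm hpqr.1) hpqr.2
    (hqmax p hp) (hrmin p hp)
  replace hq := lowerVertices_subset hq
  replace hp := lowerVertices_subset hp
  replace hr := lowerVertices_subset hr
  obtain ⟨tq1, tq2⟩ := ht q hq
  obtain ⟨tr1, tr2⟩ := ht r hr
  have h0 : 0 < α := by positivity
  have hq' : q = (p.1, p.2 + 1) := by
    by_contra hne
    obtain ⟨c₀, c₁, c₂, hz, hw⟩ := h (p.1, p.2 + 1)
    have e1 := hw p hp (by rw [Ne, Prod.ext_iff]; simp)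
    have e2 := hw q hq hne
    have e3 := hw t htV (by rw [Ne, Prod.ext_iff]; simp; omega)
    simp only [zpow_add_one₀ h0.ne'] at hz
    have g2 : 0 < α ^ p.2 := by positivity
    have f1 := zpow_le_zpow_right₀ hα.le a1
    have f2 := mul_zpow_le_zpow hα a2
    have f3 := zpow_lt_zpow_right₀ hα (show p.1 < t.1 by omega)
    have f4 := mul_zpow_le_zpow hα (show p.2 < t.2 by omega)
    have hc : c₂ < 0 := by
      by_contra! hc
      nlinarith [mul_nonneg hc (mul_pos g2 (sub_pos.2 hα)).le]
    rcases le_or_gt c₁ 0 with hc1 | hc1 <;> nlinarith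
  have hr' : r = (p.1 + 1, p.2) := by
    by_contra hne
    obtain ⟨c₀, c₁, c₂, hz, hw⟩ := h (p.1 + 1, p.2)
    have e1 := hw p hp (by rw [Ne, Prod.ext_iff]; simp)
    have e2 := hw r hr hne
    have e3 := hw t htV (by rw [Ne, Prod.ext_iff]; simp; omega)
    simp only [zpow_add_one₀ h0.ne'] at hz
    have g2 : 0 < α ^ p.1 := by positivity
    have f1 := zpow_le_zpow_right₀ hα.le a4
    have f2 := mul_zpow_le_zpow hα a3
    have f3 := zpow_lt_zpow_right₀ hα (show p.2 < t.2 by omega)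
    have f4 := mul_zpow_le_zpow hα (show p.1 < t.1 by omega)
    have hc : c₁ < 0 := by
      by_contra! hc
      nlinarith [mul_nonneg hc (mul_pos g2 (sub_pos.2 hα)).le]
    rcases le_or_gt c₂ 0 with hc1 | hc1 <;> nlinarith
  have ht' : t = (p.1 + 1, p.2 + 1) := by
    by_contra hne
    obtain ⟨c₀, c₁, c₂, hz, hw⟩ := h (p.1 + 1, p.2 + 1)
    have e1 := hw q hq (by rw [hq', Ne, Prod.ext_iff]; simp)
    have e2 := hw r hr (by rw [hr', Ne, Prod.ext_iff]; simp)
    have e3 := hw t htV hne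
    have f1 := mul_zpow_le_zpow hα (show p.1 < t.1 by omega)
    have f2 := mul_zpow_le_zpow hα (show p.2 < t.2 by omega)
    rw [hq'] at e1
    rw [hr'] at e2
    simp only [zpow_add_one₀ h0.ne'] at hz e1 e2
    have g1 : 0 < α ^ p.1 := by positivity
    have g2 : 0 < α ^ p.2 := by positivity
    have hc1 : c₁ < 0 := by
      by_contra! hc
      nlinarith [mul_nonneg hc (mul_pos g1 (sub_pos.2 hα)).le]
    have hc2 : c₂ < 0 := by
      by_contra! hc
      nlinarith [mul_nonneg hc (mul_pos g2 (sub_pos.2 hα)).le]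
    nlinarith
  have hV : V ⊆ {p, q, r, t} := by
    intro v hv
    by_contra hnot
    simp only [Finset.mem_insert, Finset.mem_singleton, not_or] at hnot
    obtain ⟨n1, n2, n3, n4⟩ := hnot
    obtain ⟨b1, b2⟩ := ht v hv
    rw [Prod.ext_iff] at n1 n2 n3 n4
    simp only [hq', hr', ht'] at n2 n3 n4 b1 b2
    by_cases hv1 : v.1 = p.1 + 1
    · exact h.not_vertical hα (q := r) htV hv (by simp [ht', hr']) (by simp [hr', hv1])
        (by simp [ht', hr']) (by simp [hr']; omega)
    by_cases hv2 : v.2 = p.2 + 1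
    · exact h.not_horizontal hα (q := q) htV hv (by simp [ht', hq']) (by simp [hq', hv2])
        (by simp [ht', hq']) (by simp [hq']; omega)
    -- Now v is weakly below and to the left of p, so p lies in the triangle q, r, v.
    obtain ⟨c₀, c₁, c₂, hz, hw⟩ := h p
    have e1 := hw q hq (Ne.symm hpqr.1)
    have e2 := hw r hr (Ne.symm hpqr.2)
    have e3 := hw v hv (by rw [Ne, Prod.ext_iff]; omega)
    rw [hq'] at e1
    rw [hr'] at e2
    simp only [zpow_add_one₀ h0.ne'] at e1 e2
    have g1 : 0 < α ^ p.1 := by positivity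
    have g2 : 0 < α ^ p.2 := by positivity
    have f1 := zpow_le_zpow_right₀ hα.le (show v.1 ≤ p.1 by omega)
    have f2 := zpow_le_zpow_right₀ hα.le (show v.2 ≤ p.2 by omega)
    have hc1 : 0 < c₁ := by
      by_contra! hc
      nlinarith [mul_nonneg (neg_nonneg.2 hc) (mul_pos g1 (sub_pos.2 hα)).le]
    have hc2 : 0 < c₂ := by
      by_contra! hc
      nlinarith [mul_nonneg (neg_nonneg.2 hc) (mul_pos g2 (sub_pos.2 hα)).le]
    nlinarith
  exact (Finset.card_le_card hV).trans Finset.card_le_four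

/-! ### Corners -/

/-- Some vertex is both rightmost and topmost. -/
def HasCornerO (V : Finset (ℤ × ℤ)) : Prop :=
  ∃ t ∈ V, ∀ w ∈ V, w.1 ≤ t.1 ∧ w.2 ≤ t.2

/-- Some vertex is leftmost and is seen from the origin with the largest slope. -/
def HasCornerX (V : Finset (ℤ × ℤ)) : Prop :=
  ∃ t ∈ V, ∀ w ∈ V, t.1 ≤ w.1 ∧ w.2 - w.1 ≤ t.2 - t.1

/-- Some vertex is lowest and is seen from the origin with the smallest slope. -/
def HasCornerY (V : Finset (ℤ × ℤ)) : Prop :=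
  ∃ t ∈ V, ∀ w ∈ V, t.2 ≤ w.2 ∧ t.2 - t.1 ≤ w.2 - w.1

lemma hasCornerO_rotate {V : Finset (ℤ × ℤ)} :
    HasCornerO (V.image rotateExp) ↔ HasCornerX V := by
  simp only [HasCornerO, HasCornerX, Finset.exists_mem_image, Finset.forall_mem_image, rotateExp]
  refine exists_congr fun t => and_congr_right fun _ => forall₂_congr fun w _ => ?_
  omega

lemma hasCornerX_rotate {V : Finset (ℤ × ℤ)} :
    HasCornerX (V.image rotateExp) ↔ HasCornerY V := by
  simp only [HasCornerX, HasCornerY, Finset.exists_mem_image, Finset.forall_mem_image, rotateExp]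
  refine exists_congr fun t => and_congr_right fun _ => forall₂_congr fun w _ => ?_
  omega

lemma hasCornerY_rotate {V : Finset (ℤ × ℤ)} :
    HasCornerY (V.image rotateExp) ↔ HasCornerO V := by
  simp only [HasCornerY, HasCornerO, Finset.exists_mem_image, Finset.forall_mem_image, rotateExp]
  refine exists_congr fun t => and_congr_right fun _ => forall₂_congr fun w _ => ?_
  omega

/-- Without either corner, the vertices of extreme slope lie strictly beyond the leftmost and lowest
ones, which traps a lattice point in a triangle of vertices. -/
lemma hasCornerX_or_hasCornerY (hα : 1 < α) {V : Finset (ℤ × ℤ)} (h : StrictlySeparated α V)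
    (hV : V.Nonempty) : HasCornerX V ∨ HasCornerY V := by
  by_contra! hcon
  obtain ⟨hX, hY⟩ := hcon
  obtain ⟨l, hl, hlmin⟩ := V.exists_min_image Prod.fst hV
  obtain ⟨d, hd, hdmin⟩ := V.exists_min_image Prod.snd hV
  obtain ⟨r, hr, hrmax⟩ := V.exists_max_image (fun v => v.2 - v.1) hV
  obtain ⟨e, he, hemin⟩ := V.exists_min_image (fun v => v.2 - v.1) hV
  have hr1 : l.1 < r.1 := by
    by_contra! hc
    exact hX ⟨r, hr, fun w hw => ⟨hc.trans (hlmin w hw), hrmax w hw⟩⟩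
  have hr2 : l.2 - l.1 < r.2 - r.1 := by
    by_contra! hc
    exact hX ⟨l, hl, fun w hw => ⟨hlmin w hw, (hrmax w hw).trans hc⟩⟩
  have he1 : d.2 < e.2 := by
    by_contra! hc
    exact hY ⟨e, he, fun w hw => ⟨hc.trans (hdmin w hw), hemin w hw⟩⟩
  have he2 : e.2 - e.1 < d.2 - d.1 := by
    by_contra! hc
    exact hY ⟨d, hd, fun w hw => ⟨hdmin w hw, hc.trans (hemin w hw)⟩⟩
  have hld := hlmin d hd
  have hdl := hdmin l hl
  have h0 : 0 < α := by positivity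
  have ho : (l.1, d.2) ∈ V := by
    by_contra hno
    have n1 : l.1 ≠ d.1 := fun heq => hno (by rwa [heq])
    have n2 : d.2 ≠ l.2 := fun heq => hno (by rwa [heq])
    -- This point lies in the triangle l, d, r: the segment from d to r crosses its height at or to
    -- the right of it.
    obtain ⟨c₀, c₁, c₂, hz, hw⟩ := h (l.1 + 1, l.2)
    have e1 := hw l hl (by rw [Ne, Prod.ext_iff]; simp)
    have e2 := hw d hd (by rw [Ne, Prod.ext_iff]; simp; omega)
    have e3 := hw r hr (by rw [Ne, Prod.ext_iff]; simp; omega)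
    simp only [zpow_add_one₀ h0.ne'] at hz
    have g1 : 0 < α ^ l.1 := by positivity
    have f1 := mul_zpow_le_zpow hα (show l.1 < d.1 by omega)
    have f2 := zpow_lt_zpow_right₀ hα (show d.2 < l.2 by omega)
    have f3 := mul_zpow_le_zpow hα hr1
    have f4 := zpow_lt_zpow_right₀ hα (show l.2 < r.2 by omega)
    have hc1 : c₁ < 0 := by
      by_contra! hc
      nlinarith [mul_nonneg hc (mul_pos g1 (sub_pos.2 hα)).le]
    rcases le_or_gt c₂ 0 with hc | hc <;> nlinarith
  -- This is α times the vertex (l.1, d.2). The segment from r to e meets their common ray at or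
  -- beyond it.
  obtain ⟨c₀, c₁, c₂, hz, hw⟩ := h (l.1 + 1, d.2 + 1)
  have e1 := hw _ ho (by simp)
  have e2 := hw r hr (by rw [Ne, Prod.ext_iff]; simp; omega)
  have e3 := hw e he (by rw [Ne, Prod.ext_iff]; simp; omega)
  simp only [zpow_add_one₀ h0.ne'] at hz e1
  have g1 : 0 < α ^ l.1 := by positivity
  have g2 : 0 < α ^ d.2 := by positivity
  have f1 := mul_zpow_le_zpow hα hr1
  have f2 := mul_zpow_le_zpow hα (show d.2 < r.2 by omega)
  have f3 := mul_zpow_le_zpow hα (show l.1 < e.1 by omega)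
  have f4 := mul_zpow_le_zpow hα he1
  have f5 : α ^ r.1 * α ^ d.2 ≤ α ^ r.2 * α ^ l.1 := by
    rw [← zpow_add₀ h0.ne', ← zpow_add₀ h0.ne']
    exact zpow_le_zpow_right₀ hα.le (by omega)
  have f6 : α ^ e.2 * α ^ l.1 ≤ α ^ e.1 * α ^ d.2 := by
    rw [← zpow_add₀ h0.ne', ← zpow_add₀ h0.ne']
    exact zpow_le_zpow_right₀ hα.le (by omega)
  have hs : c₁ * α ^ l.1 + c₂ * α ^ d.2 < 0 := by
    by_contra! hc
    nlinarith [mul_nonneg hc (sub_pos.2 hα).le]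
  have i2 : 0 < c₁ * (α ^ r.1 - α ^ l.1 * α) + c₂ * (α ^ r.2 - α ^ d.2 * α) := by linarith
  have i3 : 0 < c₁ * (α ^ e.1 - α ^ l.1 * α) + c₂ * (α ^ e.2 - α ^ d.2 * α) := by linarith
  rcases le_or_gt c₁ 0 with hc1 | hc1
  · rcases le_or_gt c₂ 0 with hc2 | hc2
    · nlinarith
    · have : c₁ * (α ^ e.1 - α ^ l.1 * α) * α ^ d.2 +
          c₂ * (α ^ e.2 - α ^ d.2 * α) * α ^ d.2 ≤ 0 := by
        have k1 : c₁ * (α ^ e.1 * α ^ d.2) ≤ c₁ * (α ^ e.2 * α ^ l.1) :=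
          mul_le_mul_of_nonpos_left f6 hc1
        have k2 := mul_nonneg (neg_nonneg.2 hs.le) (show 0 ≤ α ^ e.2 - α ^ d.2 * α by linarith)
        nlinarith
      nlinarith [mul_pos i3 g2]
  · have hc2 : c₂ < 0 := by
      by_contra! hc
      nlinarith [mul_pos hc1 g1, mul_nonneg hc g2.le]
    have : c₁ * (α ^ r.1 - α ^ l.1 * α) * α ^ l.1 + c₂ * (α ^ r.2 - α ^ d.2 * α) * α ^ l.1 ≤ 0 := by
      have k1 : c₂ * (α ^ r.2 * α ^ l.1) ≤ c₂ * (α ^ r.1 * α ^ d.2) :=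
        mul_le_mul_of_nonpos_left f5 hc2.le
      have k2 := mul_nonneg (neg_nonneg.2 hs.le) (show 0 ≤ α ^ r.1 - α ^ l.1 * α by linarith)
      nlinarith
    nlinarith [mul_pos i2 g1]

/-! ### Vertices facing away from the origin, and the count -/

/-- The vertices that `f` sends to lower vertices of the image of `V`. -/
noncomputable def lowerVerticesVia (α : ℝ) (f : ℤ × ℤ → ℤ × ℤ) (V : Finset (ℤ × ℤ)) :
    Finset (ℤ × ℤ) :=
  V.filter fun v => f v ∈ lowerVertices α (V.image f)

lemma mem_lowerVerticesVia {f : ℤ × ℤ → ℤ × ℤ} {V : Finset (ℤ × ℤ)} {v : ℤ × ℤ} :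
    v ∈ lowerVerticesVia α f V ↔ v ∈ V ∧ f v ∈ lowerVertices α (V.image f) := by
  simp [lowerVerticesVia]

lemma card_lowerVerticesVia_le {f : ℤ × ℤ → ℤ × ℤ} (hf : Function.Injective f)
    {V : Finset (ℤ × ℤ)} :
    (lowerVerticesVia α f V).card ≤ (lowerVertices α (V.image f)).card :=
  Finset.card_le_card_of_injOn f (fun _ hv => (mem_lowerVerticesVia.1 hv).2) hf.injOn

lemma SupportsAt.mem_lowerVertices {V : Finset (ℤ × ℤ)} {v : ℤ × ℤ} {c₀ c₁ c₂ : ℝ}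
    (h : SupportsAt α V v c₀ c₁ c₂) (hv : v ∈ V) (hV : V.Nontrivial) (h1 : 0 ≤ c₁)
    (h2 : 0 ≤ c₂) : v ∈ lowerVertices α V := by
  obtain ⟨u, hu, huv⟩ := hV.exists_ne v
  refine _root_.mem_lowerVertices.2 ⟨hv, c₁, c₂, h1, h2, ?_, fun w hw => ?_⟩
  · have h3 := h.1
    have h4 := h.2 u hu huv
    by_contra! hc
    have e1 : c₁ = 0 := by linarith
    have e2 : c₂ = 0 := by linarith
    subst e1 e2
    linarith
  · rcases eq_or_ne w v with rfl | hwv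
    · rfl
    · linarith [h.1, h.2 w hw hwv]

lemma image_nontrivial {V : Finset (ℤ × ℤ)} (hV : V.Nontrivial) :
    (V.image rotateExp).Nontrivial := by
  obtain ⟨a, ha, b, hb, hab⟩ := hV
  exact ⟨_, Finset.mem_coe.2 (Finset.mem_image_of_mem _ ha), _,
    Finset.mem_coe.2 (Finset.mem_image_of_mem _ hb), rotateExp_injective.ne hab⟩

/-- The vertices lying on none of the three parts of the boundary that face a vertex of the
triangle formed by the coordinate axes and the line at infinity. -/
noncomputable def remainingVertices (α : ℝ) (V : Finset (ℤ × ℤ)) : Finset (ℤ × ℤ) :=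
  V \ (lowerVertices α V ∪ lowerVerticesVia α rotateExp V ∪
    lowerVerticesVia α (rotateExp ∘ rotateExp) V)

lemma HasCornerX.mem_lowerVertices (hα : 1 < α) {V : Finset (ℤ × ℤ)} {t : ℤ × ℤ} (ht : t ∈ V)
    (h : ∀ w ∈ V, t.1 ≤ w.1 ∧ w.2 - w.1 ≤ t.2 - t.1) :
    t ∈ lowerVertices α V ∧ t ∈ lowerVerticesVia α (rotateExp ∘ rotateExp) V := by
  refine ⟨mem_lowerVertices_of_fst_le hα ht fun w hw => (h w hw).1,
    mem_lowerVerticesVia.2 ⟨ht, mem_lowerVertices_of_snd_le hα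
      (Finset.mem_image_of_mem _ ht) ?_⟩⟩
  simp only [Finset.forall_mem_image, rotateExp, Function.comp]
  intro w hw
  have := h w hw
  omega

lemma HasCornerY.mem_lowerVertices (hα : 1 < α) {V : Finset (ℤ × ℤ)} {t : ℤ × ℤ} (ht : t ∈ V)
    (h : ∀ w ∈ V, t.2 ≤ w.2 ∧ t.2 - t.1 ≤ w.2 - w.1) :
    t ∈ lowerVertices α V ∧ t ∈ lowerVerticesVia α rotateExp V := by
  refine ⟨mem_lowerVertices_of_snd_le hα ht fun w hw => (h w hw).1,
    mem_lowerVerticesVia.2 ⟨ht, mem_lowerVertices_of_fst_le hα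
      (Finset.mem_image_of_mem _ ht) ?_⟩⟩
  simp only [Finset.forall_mem_image, rotateExp]
  intro w hw
  have := h w hw
  omega

/-- If the two corners adjacent to the part facing the origin exist, every remaining vertex is
supported by a functional whose linear part is strictly negative. -/
lemma exists_supportsAt_of_mem_remainingVertices (hα : 1 < α) {V : Finset (ℤ × ℤ)}
    (h : StrictlySeparated α V) (hV : V.Nontrivial) (hX : HasCornerX V) (hY : HasCornerY V)
    {v : ℤ × ℤ} (hv : v ∈ remainingVertices α V) :
    ∃ c₀ c₁ c₂ : ℝ, 0 < c₀ ∧ c₁ < 0 ∧ c₂ < 0 ∧ SupportsAt α V v c₀ c₁ c₂ := by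
  simp only [remainingVertices, Finset.mem_sdiff, Finset.mem_union, not_or] at hv
  obtain ⟨hvV, ⟨hO, hAX⟩, hAY⟩ := hv
  obtain ⟨c₀, c₁, c₂, hc⟩ := h v
  have hV' := image_nontrivial hV
  have s0 : ¬ (0 ≤ c₁ ∧ 0 ≤ c₂) := fun hs => hO (hc.mem_lowerVertices hvV hV hs.1 hs.2)
  have s1 : ¬ (0 ≤ c₂ ∧ 0 ≤ c₀) := fun hs => hAX (mem_lowerVerticesVia.2 ⟨hvV,
    (hc.rotate hα).mem_lowerVertices (Finset.mem_image_of_mem _ hvV) hV' hs.1 hs.2⟩)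
  have s2 : ¬ (0 ≤ c₀ ∧ 0 ≤ c₁) := fun hs => hAY (mem_lowerVerticesVia.2 ⟨hvV, by
    rw [← Finset.image_image]
    exact ((hc.rotate hα).rotate hα).mem_lowerVertices
      (Finset.mem_image_of_mem _ (Finset.mem_image_of_mem _ hvV)) (image_nontrivial hV')
      hs.1 hs.2⟩)
  obtain ⟨u, hu, huv⟩ := hV.exists_ne v
  have hpos : ∀ w : ℤ × ℤ, 0 < α ^ w.1 ∧ 0 < α ^ w.2 := fun w =>
    ⟨by positivity, by positivity⟩
  have s3 : 0 < c₀ ∨ 0 < c₁ ∨ 0 < c₂ := by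
    by_contra! hs
    have := hc.2 u hu huv
    nlinarith [hpos u, mul_nonneg (neg_nonneg.2 hs.2.1) (hpos u).1.le,
      mul_nonneg (neg_nonneg.2 hs.2.2) (hpos u).2.le]
  have h0 : α ≠ 0 := by positivity
  rcases s3 with s3 | s3 | s3
  · exact ⟨c₀, c₁, c₂, s3, not_le.1 fun hs => s2 ⟨s3.le, hs⟩, not_le.1 fun hs => s1 ⟨hs, s3.le⟩,
      hc⟩
  · exfalso
    have n0 : c₀ < 0 := not_le.1 fun hs => s2 ⟨hs, s3.le⟩
    have n2 : c₂ < 0 := not_le.1 fun hs => s0 ⟨s3.le, hs⟩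
    obtain ⟨l, hl, hlmin⟩ := hX
    -- Divided by α^m, the functional is c₀α^(-m) + c₁ + c₂α^(n-m); with c₀, c₂ < 0 it is no larger
    -- at the corner l than at v, contradicting the support at v.
    have hlO := (HasCornerX.mem_lowerVertices hα hl hlmin).1
    have e1 := hc.2 l hl (by rintro rfl; exact hO hlO)
    have e2 := hc.1
    have f1 := zpow_le_zpow_right₀ hα.le (hlmin v hvV).1
    have f2 : α ^ v.2 * α ^ l.1 ≤ α ^ l.2 * α ^ v.1 := by
      rw [← zpow_add₀ h0, ← zpow_add₀ h0]
      exact zpow_le_zpow_right₀ hα.le (by have := (hlmin v hvV).2; omega)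
    nlinarith [mul_pos e1 (hpos v).1, mul_nonneg (neg_nonneg.2 e2) (hpos l).1.le,
      mul_le_mul_of_nonpos_left f1 n0.le, mul_le_mul_of_nonpos_left f2 n2.le]
  · exfalso
    have n0 : c₀ < 0 := not_le.1 fun hs => s1 ⟨s3.le, hs⟩
    have n1 : c₁ < 0 := not_le.1 fun hs => s0 ⟨hs, s3.le⟩
    obtain ⟨l, hl, hlmin⟩ := hY
    have hlO := (HasCornerY.mem_lowerVertices hα hl hlmin).1
    have e1 := hc.2 l hl (by rintro rfl; exact hO hlO)
    have e2 := hc.1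
    have f1 := zpow_le_zpow_right₀ hα.le (hlmin v hvV).1
    have f2 : α ^ v.1 * α ^ l.2 ≤ α ^ l.1 * α ^ v.2 := by
      rw [← zpow_add₀ h0, ← zpow_add₀ h0]
      exact zpow_le_zpow_right₀ hα.le (by have := (hlmin v hvV).2; omega)
    nlinarith [mul_pos e1 (hpos v).2, mul_nonneg (neg_nonneg.2 e2) (hpos l).2.le,
      mul_le_mul_of_nonpos_left f1 n0.le, mul_le_mul_of_nonpos_left f2 n1.le]

/-- These vertices form a strictly descending chain, and none is rightmost or topmost. If there were
k, the leftmost one v would have a vertex at least k steps to the right and another at least one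
step higher; with the origin on their side of the supporting line, 1/α + 1/α^k ≤ 1 contradicts the
support at v. -/
lemma card_remainingVertices_lt (hα : 1 < α) {V : Finset (ℤ × ℤ)}
    (h : StrictlySeparated α V) (hV : V.Nontrivial) (hX : HasCornerX V) (hY : HasCornerY V)
    {k : ℕ} (hk : α ≤ α ^ k * (α - 1)) (hk1 : 1 ≤ k) : (remainingVertices α V).card < k := by
  have hsupp := fun v hv => exists_supportsAt_of_mem_remainingVertices hα h hV hX hY (v := v) hv
  set R := remainingVertices α V with hR
  have hRV : R ⊆ V := Finset.sdiff_subset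
  rcases R.eq_empty_or_nonempty with hemp | hne
  · rw [hemp]
    exact hk1
  have anti : ∀ v ∈ R, ∀ w ∈ V, w ≠ v → v.1 ≤ w.1 → w.2 < v.2 := by
    intro v hv w hw hwv h1
    obtain ⟨c₀, c₁, c₂, -, n1, n2, e1, e2⟩ := hsupp v hv
    by_contra! h2
    have := e2 w hw hwv
    nlinarith [zpow_le_zpow_right₀ hα.le h1, zpow_le_zpow_right₀ hα.le h2]
  obtain ⟨v, hv, hvmin⟩ := R.exists_min_image Prod.fst hne
  obtain ⟨t, ht, htmax⟩ := V.exists_max_image Prod.snd (hne.mono hRV)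
  obtain ⟨r, hr, hrmax⟩ := V.exists_max_image Prod.fst (hne.mono hRV)
  have hinj : Set.InjOn Prod.fst (R : Set (ℤ × ℤ)) := by
    intro a ha b hb hab
    by_contra hne
    have := anti a ha b (hRV hb) (Ne.symm hne) hab.le
    have := anti b hb a (hRV ha) hne hab.ge
    omega
  have notAX : ∀ w ∈ R, ∃ u ∈ V, w.1 < u.1 := by
    intro w hw
    by_contra! hcon
    have hwR := hw
    simp only [hR, remainingVertices, Finset.mem_sdiff, Finset.mem_union, not_or] at hw
    refine hw.2.1.2 (mem_lowerVerticesVia.2 ⟨hw.1, mem_lowerVertices_of_snd_le hα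
      (Finset.mem_image_of_mem _ hw.1) ?_⟩)
    simp only [Finset.forall_mem_image, rotateExp]
    intro u hu
    have := hcon u hu
    omega
  have notAY : ∃ u ∈ V, v.2 < u.2 := by
    by_contra! hcon
    have hw := hv
    simp only [hR, remainingVertices, Finset.mem_sdiff, Finset.mem_union, not_or] at hw
    refine hw.2.2 (mem_lowerVerticesVia.2 ⟨hw.1, mem_lowerVertices_of_fst_le hα
      (Finset.mem_image_of_mem _ hw.1) ?_⟩)
    simp only [Finset.forall_mem_image, rotateExp, Function.comp]
    intro u hu
    have := hcon u hu
    omega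
  have htv : v.2 < t.2 := by
    obtain ⟨u, hu, huv⟩ := notAY
    exact huv.trans_le (htmax u hu)
  have hrR : ∀ w ∈ R, w.1 < r.1 := by
    intro w hw
    obtain ⟨u, hu, huw⟩ := notAX w hw
    exact huw.trans_le (hrmax u hu)
  by_contra! hcard
  have hlong : v.1 + k ≤ r.1 := by
    by_contra! hc
    have := card_le_of_injOn_fst hinj (i := v.1) (j := r.1 - 1) (k - 1)
      (fun w hw => ⟨hvmin w hw, by have := hrR w hw; omega⟩) (by omega)
    omega
  obtain ⟨c₀, c₁, c₂, n0, n1, n2, e1, e2⟩ := hsupp v hv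
  have i1 := e2 t ht (by rintro rfl; omega)
  have i2 := e2 r hr (by rintro rfl; omega)
  have f1 := mul_zpow_le_zpow hα htv
  have f2 := pow_mul_zpow_le_zpow hα k hlong
  have g1 : 0 < α ^ t.1 := by positivity
  have g2 : 0 < α ^ r.2 := by positivity
  have g3 : 0 < α ^ k := by positivity
  have h0 : 0 < α := by positivity
  have j1 : -c₂ * α ^ v.2 * α < c₀ := by nlinarith
  have j2 : -c₁ * α ^ v.1 * α ^ k < c₀ := by nlinarith
  nlinarith [mul_lt_mul_of_pos_left j1 g3, mul_lt_mul_of_pos_left j2 h0,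
    mul_le_mul_of_nonneg_left e1 (mul_pos h0 g3).le, mul_le_mul_of_nonneg_left hk n0.le]

lemma card_sdiff_lt_of_mem {A B : Finset (ℤ × ℤ)} {t : ℤ × ℤ} (hA : t ∈ A) (hB : t ∈ B) :
    (B \ A).card < B.card :=
  Finset.card_lt_card ⟨Finset.sdiff_subset, fun hs => (Finset.mem_sdiff.1 (hs hB)).2 hA⟩

lemma card_le_of_hasCorners (hα : 1 < α) {V : Finset (ℤ × ℤ)} (h : StrictlySeparated α V)
    (hX : HasCornerX V) (hY : HasCornerY V) {k : ℕ} (hk : α ≤ α ^ k * (α - 1)) (hk1 : 1 ≤ k) :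
    V.card ≤ 2 * k + 3 := by
  by_contra! hcard
  have hV : V.Nontrivial := Finset.one_lt_card_iff_nontrivial.1 (by omega)
  have hcardX : (lowerVerticesVia α rotateExp V).card ≤ 2 := by
    by_contra! hc
    have := card_le_four_of_card_lowerVertices hα (h.rotate hα)
      (hc.trans_le (card_lowerVerticesVia_le rotateExp_injective)) (hasCornerO_rotate.2 hX)
    rw [Finset.card_image_of_injective _ rotateExp_injective] at this
    omega
  have hcardY : (lowerVerticesVia α (rotateExp ∘ rotateExp) V).card ≤ 2 := by
    by_contra! hc
    have hle := hc.trans_le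
      (card_lowerVerticesVia_le (rotateExp_injective.comp rotateExp_injective))
    rw [← Finset.image_image] at hle
    have := card_le_four_of_card_lowerVertices hα ((h.rotate hα).rotate hα) hle
      (hasCornerO_rotate.2 (hasCornerX_rotate.2 hY))
    rw [Finset.card_image_of_injective _ rotateExp_injective,
      Finset.card_image_of_injective _ rotateExp_injective] at this
    omega
  have hO := card_lowerVertices_le hα h hk hk1
  have hR := card_remainingVertices_lt hα h hV hX hY hk hk1
  obtain ⟨x, hx, hxmin⟩ := hX
  obtain ⟨y, hy, hymin⟩ := hY
  obtain ⟨x1, x2⟩ := HasCornerX.mem_lowerVertices hα hx hxmin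
  obtain ⟨y1, y2⟩ := HasCornerY.mem_lowerVertices hα hy hymin
  have hX' := card_sdiff_lt_of_mem x1 x2
  have hY' := card_sdiff_lt_of_mem y1 y2
  have hcover : V ⊆ ((lowerVertices α V ∪
      (lowerVerticesVia α rotateExp V \ lowerVertices α V)) ∪
      (lowerVerticesVia α (rotateExp ∘ rotateExp) V \ lowerVertices α V)) ∪
      remainingVertices α V := by
    intro v hv
    simp only [remainingVertices, Finset.mem_union, Finset.mem_sdiff]
    tauto
  have h1 := Finset.card_le_card hcover
  have h2 := Finset.card_union_le ((lowerVertices α V ∪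
      (lowerVerticesVia α rotateExp V \ lowerVertices α V)) ∪
      (lowerVerticesVia α (rotateExp ∘ rotateExp) V \ lowerVertices α V)) (remainingVertices α V)
  have h3 := Finset.card_union_le (lowerVertices α V ∪
      (lowerVerticesVia α rotateExp V \ lowerVertices α V))
      (lowerVerticesVia α (rotateExp ∘ rotateExp) V \ lowerVertices α V)
  have h4 := Finset.card_union_le (lowerVertices α V)
      (lowerVerticesVia α rotateExp V \ lowerVertices α V)
  omega

theorem StrictlySeparated.card_le (hα : 1 < α) {V : Finset (ℤ × ℤ)} (h : StrictlySeparated α V)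
    {k : ℕ} (hk : α ≤ α ^ k * (α - 1)) (hk1 : 1 ≤ k) : V.card ≤ 2 * k + 3 := by
  rcases V.eq_empty_or_nonempty with rfl | hV
  · simp
  have hr := h.rotate hα
  have hrr := hr.rotate hα
  have c0 := hasCornerX_or_hasCornerY hα h hV
  have c1 := hasCornerX_or_hasCornerY hα hr (hV.image _)
  have c2 := hasCornerX_or_hasCornerY hα hrr ((hV.image _).image _)
  have b1 := fun hX hY => card_le_of_hasCorners hα hr hX hY hk hk1
  have b2 := fun hX hY => card_le_of_hasCorners hα hrr hX hY hk hk1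
  simp only [hasCornerX_rotate, hasCornerY_rotate, hasCornerO_rotate,
    Finset.card_image_of_injective _ rotateExp_injective] at c1 c2 b1 b2
  have b0 := fun hX hY => card_le_of_hasCorners hα h hX hY hk hk1
  -- Two corners exist; one of the three rotations makes them the corners opposite X and Y.
  tauto

end Exponents

/-! ### From empty polygons to exponent sets -/

section Polygons

variable {α : ℝ}

/-- The lattice point with the given exponents. -/
noncomputable def expPoint (α : ℝ) (v : ℤ × ℤ) : ℝ × ℝ := (α ^ v.1, α ^ v.2)

lemma expPoint_injective (hα : 1 < α) : Function.Injective (expPoint α) := by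
  intro v w h
  simp only [expPoint, Prod.mk.injEq] at h
  exact Prod.ext (zpow_right_injective₀ (by positivity) hα.ne' h.1)
    (zpow_right_injective₀ (by positivity) hα.ne' h.2)

lemma expPoint_mem_expLattice (hα : 1 < α) {v : ℤ × ℤ} :
    expPoint α v ∈ expLattice α ↔ 0 ≤ v.1 ∧ 0 ≤ v.2 := by
  have key : ∀ i : ℤ, α ^ i ∈ {x : ℝ | ∃ n : ℕ, α ^ n = x} ↔ 0 ≤ i := by
    intro i
    constructor
    · rintro ⟨n, hn⟩
      rw [← zpow_natCast] at hn
      have := zpow_right_injective₀ (by positivity) hα.ne' hn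
      omega
    · intro hi
      lift i to ℕ using hi
      exact ⟨i, (zpow_natCast α i).symm⟩
  simp only [expLattice, expPoint, Set.mem_prod, key]

lemma exists_expPoint_of_mem_expLattice {p : ℝ × ℝ} (hp : p ∈ expLattice α) :
    ∃ v, expPoint α v = p := by
  obtain ⟨⟨m, hm⟩, ⟨n, hn⟩⟩ := hp
  exact ⟨(m, n), Prod.ext (by simpa [expPoint] using hm) (by simpa [expPoint] using hn)⟩

lemma notMem_convexHull_of_isEmptyPolytopeIn (hα : 1 < α) {P : Set (ℝ × ℝ)}
    (hP : IsEmptyPolytopeIn (expLattice α) P) (z : ℤ × ℤ) :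
    expPoint α z ∉ convexHull ℝ (P.extremePoints ℝ \ {expPoint α z}) := by
  obtain ⟨⟨W, -, hW⟩, hS, hPS⟩ := hP
  have hconv : Convex ℝ P := hW ▸ convex_convexHull ℝ W
  by_cases hz : expPoint α z ∈ P.extremePoints ℝ
  · intro hmem
    have hd := ((hconv.mem_extremePoints_iff_convex_sdiff).1 hz).2
    exact (convexHull_min (Set.sdiff_subset_sdiff_left extremePoints_subset) hd hmem).2 rfl
  · intro hmem
    have hzP : expPoint α z ∈ P :=
      convexHull_min (Set.sdiff_subset.trans extremePoints_subset) hconv hmem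
    -- Points with a negative exponent lie outside this quadrant, so only genuine lattice points
    -- need emptiness.
    have hquad : Convex ℝ {p : ℝ × ℝ | 1 ≤ p.1 ∧ 1 ≤ p.2} :=
      (convex_Ici (𝕜 := ℝ) (1 : ℝ × ℝ))
    have hge : 1 ≤ α ^ z.1 ∧ 1 ≤ α ^ z.2 := by
      refine convexHull_min ?_ hquad hmem
      rintro p ⟨hp, -⟩
      obtain ⟨⟨m, hm⟩, ⟨n, hn⟩⟩ := hS hp
      exact ⟨hm ▸ one_le_pow₀ hα.le, hn ▸ one_le_pow₀ hα.le⟩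
    refine hz (hPS ⟨hzP, (expPoint_mem_expLattice hα).2 ⟨?_, ?_⟩⟩)
    · by_contra! hlt
      exact (zpow_lt_one_of_neg₀ hα hlt).not_ge hge.1
    · by_contra! hlt
      exact (zpow_lt_one_of_neg₀ hα hlt).not_ge hge.2

lemma encard_extremePoints_le (hα : 1 < α) {P : Set (ℝ × ℝ)}
    (hP : IsEmptyPolytopeIn (expLattice α) P) {k : ℕ} (hk : α ≤ α ^ k * (α - 1)) (hk1 : 1 ≤ k) :
    (P.extremePoints ℝ).encard ≤ (2 * k + 3 : ℕ) := by
  have hfin : (P.extremePoints ℝ).Finite := by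
    obtain ⟨W, hWfin, rfl⟩ := hP.1
    exact hWfin.subset extremePoints_convexHull_subset
  have hVfin : (expPoint α ⁻¹' P.extremePoints ℝ).Finite :=
    hfin.preimage (expPoint_injective hα).injOn
  have hsep : StrictlySeparated α hVfin.toFinset := by
    intro z
    obtain ⟨f, u, hfz, hf⟩ := geometric_hahn_banach_point_closed (convex_convexHull ℝ _)
      ((hfin.subset Set.sdiff_subset).isClosed_convexHull ℝ)
      (notMem_convexHull_of_isEmptyPolytopeIn hα hP z)
    have key : ∀ v : ℤ × ℤ, f (expPoint α v) = f (1, 0) * α ^ v.1 + f (0, 1) * α ^ v.2 := by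
      intro v
      have : expPoint α v = α ^ v.1 • ((1, 0) : ℝ × ℝ) + α ^ v.2 • ((0, 1) : ℝ × ℝ) := by
        simp [expPoint]
      rw [this, map_add, map_smul, map_smul, smul_eq_mul, smul_eq_mul]
      ring
    refine ⟨-u, f (1, 0), f (0, 1), ?_, fun w hw hwz => ?_⟩
    · have := key z
      linarith
    · have h1 := hf (expPoint α w) (subset_convexHull ℝ _
        ⟨hVfin.mem_toFinset.1 hw, (expPoint_injective hα).ne hwz⟩)
      have := key w
      linarith
  have himage : expPoint α '' (expPoint α ⁻¹' P.extremePoints ℝ) = P.extremePoints ℝ :=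
    Set.image_preimage_eq_of_subset fun p hp => exists_expPoint_of_mem_expLattice (hP.2.1 hp)
  rw [← himage, (expPoint_injective hα).encard_image, hVfin.encard_eq_coe_toFinset_card]
  exact_mod_cast hsep.card_le hα hk hk1

theorem maxEmptyVertices_expLattice_le (hα : 1 < α) {k : ℕ} (hk : α ≤ α ^ k * (α - 1))
    (hk1 : 1 ≤ k) : maxEmptyVertices (expLattice α) ≤ (2 * k + 3 : ℕ) :=
  iSup₂_le fun _ hP => encard_extremePoints_le hα hP hk hk1

lemma le_pow_ceil_logb_mul (hα : 1 < α) :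
    α ≤ α ^ ⌈Real.logb α (α / (α - 1))⌉₊ * (α - 1) ∧ 1 ≤ ⌈Real.logb α (α / (α - 1))⌉₊ := by
  have h1 : 0 < α - 1 := sub_pos.2 hα
  have h2 : 1 < α / (α - 1) := (one_lt_div h1).2 (by linarith)
  refine ⟨?_, Nat.one_le_ceil_iff.2 (Real.logb_pos hα h2)⟩
  rw [← div_le_iff₀ h1, ← Real.rpow_natCast,
    ← Real.logb_le_iff_le_rpow hα (by positivity)]
  exact Nat.le_ceil _

end Polygons

theorem mainTheorem1 :
    (∀ α : ℝ, 1 < α → maxEmptyVertices (expLattice α) < ⊤) ∧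
    (∀ α : ℝ, 2 ≤ α → maxEmptyVertices (expLattice α) ≤ 5) ∧
    (∀ α : ℝ, α ∈ Set.Ico ((1 + Real.sqrt 5) / 2) 2 → maxEmptyVertices (expLattice α) ≤ 7) ∧
    (∀ α : ℝ, α ∈ Set.Ioo 1 ((1 + Real.sqrt 5) / 2) →
      maxEmptyVertices (expLattice α) ≤
        ((3 * ⌈Real.logb α (α / (α - 1))⌉₊ + 3 : ℕ) : ℕ∞)) := by
  refine ⟨fun α hα => ?_, fun α hα => ?_, fun α hα => ?_, fun α hα => ?_⟩
  · obtain ⟨hk, hk1⟩ := le_pow_ceil_logb_mul hα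
    exact (maxEmptyVertices_expLattice_le hα hk hk1).trans_lt (ENat.natCast_lt_top _)
  · exact maxEmptyVertices_expLattice_le (k := 1) (by linarith) (by nlinarith) le_rfl
  · have h5 : Real.sqrt 5 ^ 2 = 5 := Real.sq_sqrt (by norm_num)
    have h2 : 2 < Real.sqrt 5 := (Real.lt_sqrt (by norm_num)).2 (by norm_num)
    have hα1 : 1 < α := by linarith [hα.1]
    have hsq : α + 1 ≤ α ^ 2 := by nlinarith [hα.1]
    exact maxEmptyVertices_expLattice_le (k := 2) hα1 (by nlinarith) (by norm_num)
  · obtain ⟨hk, hk1⟩ := le_pow_ceil_logb_mul hα.1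
    refine (maxEmptyVertices_expLattice_le hα.1 hk hk1).trans ?_
    exact_mod_cast (by omega : 2 * ⌈Real.logb α (α / (α - 1))⌉₊ + 3 ≤
      3 * ⌈Real.logb α (α / (α - 1))⌉₊ + 3)
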